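/- Consider a wireless ad hoc network with slotted ALOHA access. Transmitters form a homogeneous Poisson point process of density $\lambda>0$ in the plane; each has a receiver at distance $d>0$, path-loss exponent $\alpha>2$, independent Rayleigh fading of a common scale, unit transmit power and no noise. In each slot, independently across transmitters, a unit of energy arrives with probability $p\in(0,1]$; it is stored in a battery of finite capacity $B\ge 1$, and a transmitter with a non-empty battery transmits with its own access probability $q\in[0,1]$, spending one unit. Thus the battery level is a birth–death chain on $\{0,\dots,B\}$: $0\to1$ has probability $p$, $i\to i+1$ has probability $p(1-q)$ for $1\le i<B$, $i\to i-1$ has probability $q(1-p)$ for $1\le i\le B$, and otherwise the level stays. Let $r(q)$ be the stationary probability of a non-empty battery; batteries are assumed stationary. A transmission succeeds if the signal-to-interference ratio at its receiver exceeds $\theta>0$, and a success carries rate $R>0$ (for instance $R=\log_2(1+\theta)$, or $R=1$ if throughput is measured in units of that rate). Let $\mathsf{TH}(q,\tilde q)=r(q)\,q\,\mathbb P(\mathsf{SIR}>\theta)\,R$ be the throughput of a typical transmitter that uses $q$ when all others use $\tilde q$, where $\mathsf{SIR}$ is computed with the other transmitters forming a Poisson process of density $\lambda$, each of them active when its battery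 is non-empty and it decides to access the channel. A symmetric Nash equilibrium (SNE) is $q^*\in[0,1]$ with $\mathsf{TH}(q^*,q^*)=\max_{q\in[0,1]}\mathsf{TH}(q,q^*)$, and the transmission capacity at $q^*$ is $C=\lambda\,\mathsf{TH}(q^*,q^*)$. Put $$\lambda_{\max}=\frac{1}{d^2\theta^{2/\alpha}\kappa(\alpha)},\qquad \kappa(\alpha)=\frac{2\pi^2}{\alpha\sin(2\pi/\alpha)}.$$ Then $q^*=1$ is an SNE, and at any SNE each transmitter's throughput is $$\mathsf{TH}=R\,p\exp\left(-\frac{p\lambda}{\lambda_{\max}}\right)$$ and the transmission capacity is $$C=R\,\lambda p\exp\left(-\frac{p\lambda}{\lambda_{\max}}\right).$$ -/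

import Mathlib

open MeasureTheory ProbabilityTheory Set
open scoped ENNReal NNReal

noncomputable section

namespace EHAloha

/-- The plane in which the nodes live; its `volume` is Lebesgue measure. -/
abbrev Plane : Type := EuclideanSpace ℝ (Fin 2)

/-! ### Poisson point processes and Rayleigh fading -/

/-- The number of points of the (enumerated) point process `X` that lie in `A`. -/
def pointCount {Ω : Type*} (X : ℕ → Ω → Plane) (A : Set Plane) (ω : Ω) : ℕ∞ :=
  {s : ℕ | X s ω ∈ A}.encard

/-- The random points `X 0, X 1, …` form a homogeneous Poisson point process of density `lam`:
the number of points in a Borel set of finite area is Poisson with mean `lam` times the area, and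
the numbers of points in disjoint Borel sets are independent. -/
structure IsPoissonPointProcess {Ω : Type*} [MeasurableSpace Ω] (μ : Measure Ω)
    (X : ℕ → Ω → Plane) (lam : ℝ) : Prop where
  measurable : ∀ s, Measurable (X s)
  count_law : ∀ A : Set Plane, MeasurableSet A → volume A ≠ ∞ →
    HasLaw (pointCount X A)
      ((poissonMeasure (lam.toNNReal * (volume A).toNNReal)).map (Nat.cast : ℕ → ℕ∞)) μ
  count_indep : ∀ (n : ℕ) (A : Fin n → Set Plane), (∀ i, MeasurableSet (A i)) →
    Pairwise (fun i j => Disjoint (A i) (A j)) → iIndepFun (fun i => pointCount X (A i)) μ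

/-- The Rayleigh distribution with scale `sigma`, of density
`x / sigma ^ 2 * exp (-x ^ 2 / (2 * sigma ^ 2))` on the positive half-line. -/
def rayleighMeasure (sigma : ℝ) : Measure ℝ :=
  volume.withDensity fun x =>
    ENNReal.ofReal (if 0 < x then x / sigma ^ 2 * Real.exp (-x ^ 2 / (2 * sigma ^ 2)) else 0)

/-! ### The energy queue -/

/-- Probability that the battery level goes from `i` to `i + 1` in one slot: energy arrives
(probability `p`), and no unit is spent (probability `1 - q`, or `1` if the battery is empty);
a full battery cannot grow. -/
def upProb (p q : ℝ) (B i : ℕ) : ℝ :=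
  if i = B then 0 else if i = 0 then p else p * (1 - q)

/-- Probability that the battery level goes from `i` to `i - 1` in one slot: one unit is spent on
a transmission (probability `q`) and no energy arrives (probability `1 - p`). -/
def downProb (p q : ℝ) (i : ℕ) : ℝ :=
  if i = 0 then 0 else q * (1 - p)

/-- Transition matrix of the birth-death chain on `{0, …, B}` followed by the energy in a battery
of capacity `B`, for energy arrival rate `p` and transmission probability `q`. -/
def queueMatrix (p q : ℝ) (B : ℕ) : Matrix (Fin (B + 1)) (Fin (B + 1)) ℝ :=
  fun i j =>
    if (j : ℕ) = i + 1 then upProb p q B i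
    else if (i : ℕ) = j + 1 then downProb p q i
    else if (i : ℕ) = j then 1 - upProb p q B i - downProb p q i
    else 0

/-- `v` is a stationary probability distribution of the energy queue. -/
def IsStationaryLaw (p q : ℝ) (B : ℕ) (v : Fin (B + 1) → ℝ) : Prop :=
  v ∈ stdSimplex ℝ (Fin (B + 1)) ∧ Matrix.vecMul v (queueMatrix p q B) = v

/-! ### The network -/

/-- Parameters of the network. -/
structure Params where
  /-- energy arrival rate of the Bernoulli harvesting process -/
  p : ℝ
  /-- battery capacity -/
  B : ℕ
  /-- density of the transmitters -/
  lam : ℝ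
  /-- distance between a transmitter and its receiver -/
  d : ℝ
  /-- path-loss exponent -/
  α : ℝ
  /-- SIR threshold for a successful transmission -/
  θ : ℝ
  /-- rate carried by a successful transmission -/
  R : ℝ
  /-- scale of the Rayleigh fading -/
  sigma : ℝ
  p_pos : 0 < p
  p_le_one : p ≤ 1
  one_le_B : 1 ≤ B
  lam_pos : 0 < lam
  d_pos : 0 < d
  two_lt_α : 2 < α
  θ_pos : 0 < θ
  R_pos : 0 < R
  sigma_pos : 0 < sigma

/-- `κ(α) = 2π² / (α sin (2π/α))`. -/
def Params.kappa (P : Params) : ℝ :=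
  2 * Real.pi ^ 2 / (P.α * Real.sin (2 * Real.pi / P.α))

/-- `λ_max = 1 / (d² θ^(2/α) κ(α))`. -/
def Params.lamMax (P : Params) : ℝ :=
  1 / (P.d ^ 2 * P.θ ^ (2 / P.α) * P.kappa)

/-- Received power over a link of length `x > 0` with fading coefficient `h`, at unit transmit
power (an interferer is almost surely not at distance `0`). -/
def Params.rxPower (P : Params) (x : ℝ) (h : ℂ) : ℝ≥0∞ :=
  ENNReal.ofReal (x ^ (-P.α) * ‖h‖ ^ 2)

/-- The network in a slot, seen from a typical transmitter located at the origin. The other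
transmitters (the interferers) form a Poisson process. The battery levels and access decisions
depend on the transmission probability `q` which the interferers use. -/
structure Network (P : Params) {Ω : Type*} [MeasurableSpace Ω] (μ : Measure Ω) where
  /-- location of the receiver of the typical transmitter -/
  receiver : Plane
  receiver_dist : dist (0 : Plane) receiver = P.d
  /-- locations of the interferers -/
  loc : ℕ → Ω → Plane
  loc_poisson : IsPoissonPointProcess μ loc P.lam
  /-- fading coefficient from the typical transmitter to its receiver -/
  ownFading : Ω → ℂ
  ownFading_measurable : Measurable ownFading
  ownFading_law : HasLaw (fun ω => ‖ownFading ω‖) (rayleighMeasure P.sigma) μ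
  /-- fading coefficients from the interferers to that receiver -/
  fading : ℕ → Ω → ℂ
  fading_measurable : ∀ s, Measurable (fading s)
  fading_law : ∀ s, HasLaw (fun ω => ‖fading s ω‖) (rayleighMeasure P.sigma) μ
  /-- stationary distribution of the battery level of a transmitter that uses `q` -/
  energyLaw : ℝ → Fin (P.B + 1) → ℝ
  energyLaw_stationary : ∀ q ∈ Icc (0 : ℝ) 1, IsStationaryLaw P.p q P.B (energyLaw q)
  /-- battery levels of the interferers when they all use `q` -/
  energy : ℝ → ℕ → Ω → Fin (P.B + 1)
  energy_measurable : ∀ q ∈ Icc (0 : ℝ) 1, ∀ s, Measurable (energy q s)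
  energy_law : ∀ q ∈ Icc (0 : ℝ) 1, ∀ s k, μ.real {ω | energy q s ω = k} = energyLaw q k
  /-- ALOHA access decisions of the interferers when they all use `q` -/
  access : ℝ → ℕ → Ω → Bool
  access_measurable : ∀ q ∈ Icc (0 : ℝ) 1, ∀ s, Measurable (access q s)
  access_law : ∀ q ∈ Icc (0 : ℝ) 1, ∀ s, μ.real {ω | access q s ω = true} = q
  /-- the locations are independent of everything else -/
  indep_loc : ∀ q ∈ Icc (0 : ℝ) 1,
    IndepFun (fun ω s => loc s ω)
      (fun ω => (ownFading ω, fun s => (fading s ω, energy q s ω, access q s ω))) μ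
  /-- the typical link's fading is independent of the fading and the activity of the others -/
  indep_ownFading : ∀ q ∈ Icc (0 : ℝ) 1,
    IndepFun ownFading (fun ω s => (fading s ω, energy q s ω, access q s ω)) μ
  /-- independence across the interferers -/
  indep_marks : ∀ q ∈ Icc (0 : ℝ) 1,
    iIndepFun (fun s ω => (fading s ω, energy q s ω, access q s ω)) μ
  /-- for each interferer, fading, battery level and access decision are independent -/
  indep_fading : ∀ q ∈ Icc (0 : ℝ) 1, ∀ s,
    IndepFun (fading s) (fun ω => (energy q s ω, access q s ω)) μ
  indep_access : ∀ q ∈ Icc (0 : ℝ) 1, ∀ s, IndepFun (energy q s) (access q s) μ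

namespace Network

variable {P : Params} {Ω : Type*} [MeasurableSpace Ω] {μ : Measure Ω}

/-- Interferer `s` transmits: it has energy and decides to access the channel. -/
def Transmits (N : Network P μ) (q : ℝ) (s : ℕ) (ω : Ω) : Prop :=
  1 ≤ (N.energy q s ω : ℕ) ∧ N.access q s ω = true

open Classical in
/-- Total interference at the receiver of the typical transmitter when the others use `q`. -/
def interference (N : Network P μ) (q : ℝ) (ω : Ω) : ℝ≥0∞ :=
  ∑' s, if N.Transmits q s ω then P.rxPower (dist (N.loc s ω) N.receiver) (N.fading s ω) else 0

/-- Signal to interference ratio of the typical link, with value `∞` if there is a signal and no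
interference. -/
def SIR (N : Network P μ) (q : ℝ) (ω : Ω) : ℝ≥0∞ :=
  P.rxPower P.d (N.ownFading ω) / N.interference q ω

/-- Success probability of the typical link when the other transmitters use `q`. -/
def successProb (N : Network P μ) (q : ℝ) : ℝ :=
  μ.real {ω | ENNReal.ofReal P.θ < N.SIR q ω}

/-- `r`, the probability that a transmitter using `q` has at least one unit of energy. -/
def activeProb (N : Network P μ) (q : ℝ) : ℝ :=
  ∑ k : Fin (P.B + 1), if 1 ≤ (k : ℕ) then N.energyLaw q k else 0

/-- `TH(q, q')`: throughput of a transmitter that uses `q` while all the others use `q'`. -/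
def throughput (N : Network P μ) (q q' : ℝ) : ℝ :=
  N.activeProb q * q * N.successProb q' * P.R

/-- Symmetric Nash equilibrium: `q` is a best reply in `[0, 1]` to everybody else using `q`. -/
def IsSNE (N : Network P μ) (q : ℝ) : Prop :=
  q ∈ Icc (0 : ℝ) 1 ∧ ∀ x ∈ Icc (0 : ℝ) 1, N.throughput x q ≤ N.throughput q q

/-- Transmission capacity when everybody uses `q`: the sum throughput per unit area. -/
def capacity (N : Network P μ) (q : ℝ) : ℝ :=
  P.lam * N.throughput q q

end Network

end EHAloha

end

/-!
In stationarity the battery level has zero mean drift. Since energy is lost only at a full battery,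
when a unit arrives and none is spent, this reads `r(q) q = p - p (1 - q) v(B)` with `v` the
stationary law. So `r(q) q ≤ p`, with equality at `q = 1`. The strategy of the others enters the
throughput of a transmitter only through a positive factor, hence `1` is always a best reply and
`r(q) q = p` at every equilibrium `q`.

The power received over a Rayleigh link is exponentially distributed, so the success probability is
the Laplace transform of the interference. The interferers form an independently marked Poisson
process: averaging over the marks leaves the Laplace functional of a Poisson process of density `λ`,
evaluated at a function whose integral over the plane is computed from the reflection formula for
the Gamma function. With `a = r(q) q` this gives the success probability `exp (-a λ / λ_max)`.
-/

noncomputable section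

namespace EHAloha

open Filter Topology

/-! ### The negative exponential on `[0, ∞]` -/

/-- `t ↦ e⁻ᵗ` on `[0, ∞]`, with `e^(-∞) = 0`; it lets Laplace transforms of sums and integrals be
computed without separating off the case where these are infinite. -/
def expNeg (t : ℝ≥0∞) : ℝ≥0∞ := EReal.exp (-(t : EReal))

@[simp] lemma expNeg_zero : expNeg 0 = 1 := by simp [expNeg]

@[simp] lemma expNeg_top : expNeg ∞ = 0 := by simp [expNeg]

lemma expNeg_add (s t : ℝ≥0∞) : expNeg (s + t) = expNeg s * expNeg t := by
  simp only [expNeg, EReal.exp_neg, EReal.coe_ennreal_add, EReal.exp_add]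
  exact ENNReal.mul_inv (Or.inl (by simp)) (Or.inr (by simp))

lemma expNeg_sum {ι : Type*} (s : Finset ι) (f : ι → ℝ≥0∞) :
    expNeg (∑ i ∈ s, f i) = ∏ i ∈ s, expNeg (f i) := by
  classical
  induction s using Finset.induction_on with
  | empty => simp
  | insert a s ha ih => rw [Finset.sum_insert ha, Finset.prod_insert ha, expNeg_add, ih]

lemma expNeg_nat_mul (n : ℕ) (c : ℝ≥0∞) : expNeg (n * c) = expNeg c ^ n := by
  simpa using expNeg_sum (Finset.range n) fun _ => c

lemma continuous_expNeg : Continuous expNeg :=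
  ENNReal.continuous_exp.comp (continuous_neg.comp continuous_coe_ennreal_ereal)

@[fun_prop] lemma measurable_expNeg : Measurable expNeg := continuous_expNeg.measurable

lemma antitone_expNeg : Antitone expNeg := fun s t h => by simpa [expNeg] using h

lemma expNeg_le_one (t : ℝ≥0∞) : expNeg t ≤ 1 := by simpa using antitone_expNeg zero_le

lemma expNeg_ofReal {t : ℝ} (ht : 0 ≤ t) :
    expNeg (ENNReal.ofReal t) = ENNReal.ofReal (Real.exp (-t)) := by
  rw [expNeg, EReal.coe_ennreal_ofReal, max_eq_left ht, ← EReal.coe_neg, EReal.exp_coe]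

lemma expNeg_toENNReal_neg_log {z : ℝ≥0∞} (hz : z ≤ 1) :
    expNeg (-ENNReal.log z).toENNReal = z := by
  have hlog : ENNReal.log z ≤ 0 := by simpa using ENNReal.log_monotone hz
  rw [expNeg, EReal.coe_toENNReal (by simpa using hlog), neg_neg, ENNReal.exp_log]

lemma tendsto_lintegral_expNeg {Ω : Type*} [MeasurableSpace Ω] {μ : Measure Ω}
    [IsFiniteMeasure μ] {F : ℕ → Ω → ℝ≥0∞} {f : Ω → ℝ≥0∞} (hF : ∀ n, Measurable (F n))
    (h : ∀ ω, Tendsto (fun n => F n ω) atTop (𝓝 (f ω))) :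
    Tendsto (fun n => ∫⁻ ω, expNeg (F n ω) ∂μ) atTop (𝓝 (∫⁻ ω, expNeg (f ω) ∂μ)) :=
  tendsto_lintegral_of_dominated_convergence (fun _ => 1)
    (fun n => measurable_expNeg.comp (hF n)) (fun _ => ae_of_all _ fun _ => expNeg_le_one _)
    (by simp) (ae_of_all _ fun ω => (continuous_expNeg.tendsto _).comp (h ω))

/-! ### Laplace transforms and independence -/

section Independence

variable {Ω β γ δ : Type*} [MeasurableSpace Ω] [MeasurableSpace β] [MeasurableSpace γ]
  [MeasurableSpace δ] {μ : Measure Ω}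

lemma lintegral_comp_of_indepFun [IsFiniteMeasure μ] {X : Ω → β} {Y : Ω → γ} (h : IndepFun X Y μ)
    (hX : Measurable X) (hY : Measurable Y) {f : β × γ → ℝ≥0∞} (hf : Measurable f) :
    ∫⁻ ω, f (X ω, Y ω) ∂μ = ∫⁻ ω, ∫⁻ ω', f (X ω, Y ω') ∂μ ∂μ := by
  have hmap := (indepFun_iff_map_prod_eq_prod_map_map hX.aemeasurable hY.aemeasurable).1 h
  rw [← lintegral_map hf (hX.prodMk hY), hmap, lintegral_prod _ hf.aemeasurable,
    lintegral_map hf.lintegral_prod_right' hX]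
  exact lintegral_congr fun ω => lintegral_map (hf.comp measurable_prodMk_left) hY

lemma indepFun_prodMk_of_indepFun [IsFiniteMeasure μ] {X : Ω → β} {Y : Ω → γ} {Z : Ω → δ}
    (hX : Measurable X) (hY : Measurable Y) (hZ : Measurable Z)
    (hXYZ : IndepFun X (fun ω => (Y ω, Z ω)) μ) (hYZ : IndepFun Y Z μ) :
    IndepFun Y (fun ω => (X ω, Z ω)) μ := by
  have hXZ : IndepFun X Z μ := hXYZ.comp measurable_id measurable_snd
  rw [indepFun_iff_map_prod_eq_prod_map_map hY.aemeasurable (hX.prodMk hZ).aemeasurable]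
  refine Measure.ext_prod₃ fun {s t u} hs ht hu => ?_
  have hsplit : μ (X ⁻¹' t ∩ (Y ⁻¹' s ∩ Z ⁻¹' u)) = μ (X ⁻¹' t) * μ (Y ⁻¹' s ∩ Z ⁻¹' u) :=
    hXYZ.measure_inter_preimage_eq_mul t (s ×ˢ u) ht (hs.prod hu)
  rw [Measure.map_apply (hY.prodMk (hX.prodMk hZ)) (hs.prod (ht.prod hu)), Measure.prod_prod,
    Measure.map_apply hY hs, Measure.map_apply (hX.prodMk hZ) (ht.prod hu), mk_preimage_prod,
    mk_preimage_prod, hXZ.measure_inter_preimage_eq_mul t u ht hu, inter_left_comm, hsplit,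
    hYZ.measure_inter_preimage_eq_mul s u hs hu, mul_left_comm]

lemma lintegral_expNeg_tsum_of_iIndepFun [IsFiniteMeasure μ] {F : ℕ → Ω → ℝ≥0∞}
    (hF : ∀ s, Measurable (F s)) (hind : iIndepFun F μ) {G : ℕ → ℝ≥0∞}
    (hG : ∀ s, ∫⁻ ω, expNeg (F s ω) ∂μ = expNeg (G s)) :
    ∫⁻ ω, expNeg (∑' s, F s ω) ∂μ = expNeg (∑' s, G s) := by
  have hpartial : ∀ n, ∫⁻ ω, expNeg (∑ s ∈ Finset.range n, F s ω) ∂μ =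
      expNeg (∑ s ∈ Finset.range n, G s) := fun n => by
    have hindexp : iIndepFun (fun s ω => expNeg (F s ω)) μ :=
      hind.comp (fun _ => expNeg) fun _ => measurable_expNeg
    simp only [expNeg_sum]
    rw [lintegral_prod_eq_prod_lintegral_of_indepFun _ _ hindexp
      fun s => measurable_expNeg.comp (hF s)]
    exact Finset.prod_congr rfl fun s _ => hG s
  have hleft := tendsto_lintegral_expNeg (μ := μ)
    (fun n => Finset.measurable_fun_sum (Finset.range n) fun s _ => hF s)
    fun ω => (ENNReal.summable (f := fun s => F s ω)).hasSum.tendsto_sum_nat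
  have hright := (continuous_expNeg.tendsto _).comp
    (ENNReal.summable (f := G)).hasSum.tendsto_sum_nat
  exact tendsto_nhds_unique (hleft.congr hpartial) hright

lemma lintegral_expNeg_indicator_of_indepFun {S : Ω → ℝ≥0∞} {Y : Ω → γ} (hS : Measurable S)
    (hY : Measurable Y) (h : IndepFun S Y μ) {B : Set γ} (hB : MeasurableSet B) :
    ∫⁻ ω, expNeg ((Y ⁻¹' B).indicator S ω) ∂μ =
      μ (Y ⁻¹' B) * ∫⁻ ω, expNeg (S ω) ∂μ + μ (Y ⁻¹' B)ᶜ := by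
  have hsplit : ∀ ω, expNeg ((Y ⁻¹' B).indicator S ω) =
      B.indicator 1 (Y ω) * expNeg (S ω) + (Y ⁻¹' B)ᶜ.indicator 1 ω := fun ω => by
    by_cases hω : Y ω ∈ B <;> simp [hω]
  have hprod : ∫⁻ ω, B.indicator 1 (Y ω) * expNeg (S ω) ∂μ =
      (∫⁻ ω, B.indicator 1 (Y ω) ∂μ) * ∫⁻ ω, expNeg (S ω) ∂μ :=
    lintegral_mul_eq_lintegral_mul_lintegral_of_indepFun
      ((measurable_one.indicator hB).comp hY) (measurable_expNeg.comp hS)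
      (h.symm.comp (measurable_one.indicator hB) measurable_expNeg)
  simp_rw [hsplit]
  rw [lintegral_add_right _ (measurable_one.indicator (hY hB).compl),
    lintegral_indicator_one (hY hB).compl, hprod]
  congr 2
  exact lintegral_indicator_one (hY hB)

lemma measure_lt_div_eq_lintegral_expNeg [IsFiniteMeasure μ] {S I : Ω → ℝ≥0∞}
    (hS : Measurable S) (hI : Measurable I) (h : IndepFun S I μ) {b θ : ℝ≥0∞} (hb : b ≠ 0)
    (hexp : ∀ t, μ {ω | t < S ω} = expNeg (b * t)) (hθ : θ ≠ 0) (hθ' : θ ≠ ∞) :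
    μ {ω | θ < S ω / I ω} = ∫⁻ ω, expNeg (b * (θ * I ω)) ∂μ := by
  let E : Set (ℝ≥0∞ × ℝ≥0∞) := {z | θ < z.2 / z.1}
  have hE : MeasurableSet E :=
    measurableSet_lt measurable_const (measurable_snd.div measurable_fst)
  have hsection : ∀ i, μ {ω | θ < S ω / i} = expNeg (b * (θ * i)) := fun i => by
    obtain rfl | hi := eq_or_ne i ∞
    · simp [hb, hθ]
    · simp_rw [ENNReal.lt_div_iff_mul_lt (Or.inr hθ') (Or.inl hi), hexp]
  calc
    μ {ω | θ < S ω / I ω} = ∫⁻ ω, E.indicator 1 (I ω, S ω) ∂μ :=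
      (lintegral_indicator_one (hE.preimage (hI.prodMk hS))).symm
    _ = ∫⁻ ω, ∫⁻ ω', E.indicator 1 (I ω, S ω') ∂μ ∂μ :=
      lintegral_comp_of_indepFun h.symm hI hS (measurable_one.indicator hE)
    _ = ∫⁻ ω, μ {ω' | θ < S ω' / I ω} ∂μ := lintegral_congr fun ω =>
      lintegral_indicator_one (hE.preimage (measurable_const.prodMk hS))
    _ = ∫⁻ ω, expNeg (b * (θ * I ω)) ∂μ := lintegral_congr fun ω => hsection (I ω)

end Independence

/-! ### The Laplace functional of a Poisson point process -/

lemma lintegral_pow_poissonMeasure (m : ℝ≥0) {z : ℝ≥0} (hz : z ≤ 1) :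
    ∫⁻ n : ℕ, (z : ℝ≥0∞) ^ n ∂(poissonMeasure m) = expNeg (m * (1 - z)) := by
  have hz' : (0 : ℝ) ≤ 1 - z := sub_nonneg.2 (by exact_mod_cast hz)
  have hsum : HasSum (fun n : ℕ => Real.exp (-m) * ((z * m : ℝ) ^ n / n.factorial))
      (Real.exp (-(m * (1 - z)))) := by
    have hexp : Real.exp (-(m * (1 - z))) = Real.exp (-m) * Real.exp (z * m) := by
      rw [← Real.exp_add]; ring_nf
    rw [hexp, Real.exp_eq_exp_ℝ]
    exact (NormedSpace.expSeries_div_hasSum_exp (z * m : ℝ)).mul_left _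
  have hterm : ∀ n : ℕ, (z : ℝ≥0∞) ^ n * poissonMeasure m {n} =
      ENNReal.ofReal (Real.exp (-m) * ((z * m : ℝ) ^ n / n.factorial)) := fun n => by
    rw [poissonMeasure_singleton, ← ENNReal.ofReal_coe_nnreal, ← ENNReal.ofReal_pow z.coe_nonneg,
      ← ENNReal.ofReal_mul (by positivity), mul_pow]
    ring_nf
  calc
    ∫⁻ n : ℕ, (z : ℝ≥0∞) ^ n ∂(poissonMeasure m) =
        ∑' n : ℕ, ENNReal.ofReal (Real.exp (-m) * ((z * m : ℝ) ^ n / n.factorial)) := by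
      rw [lintegral_countable']; exact tsum_congr hterm
    _ = ENNReal.ofReal (Real.exp (-(m * (1 - z)))) := by
      rw [← ENNReal.ofReal_tsum_of_nonneg (fun n => by positivity) hsum.summable, hsum.tsum_eq]
    _ = expNeg (m * (1 - z)) := by
      rw [← expNeg_ofReal (by positivity), ENNReal.ofReal_mul m.coe_nonneg,
        ENNReal.ofReal_sub _ z.coe_nonneg]
      simp

lemma lintegral_expNeg_poissonMeasure (m : ℝ≥0) (c : ℝ≥0∞) :
    ∫⁻ n : ℕ, expNeg (n * c) ∂(poissonMeasure m) = expNeg (m * (1 - expNeg c)) := by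
  lift expNeg c to ℝ≥0 using ((expNeg_le_one c).trans_lt ENNReal.one_lt_top).ne with z hz
  have hz1 : z ≤ 1 := by exact_mod_cast hz ▸ expNeg_le_one c
  simp_rw [expNeg_nat_mul, ← hz, lintegral_pow_poissonMeasure m hz1]

section PointCount

variable {Ω : Type*} (X : ℕ → Ω → Plane)

lemma tsum_indicator_eq_pointCount_mul (A : Set Plane) (c : ℝ≥0∞) (ω : Ω) :
    ∑' s, A.indicator (fun _ => c) (X s ω) = pointCount X A ω * c := by
  rw [pointCount, ← ENNReal.tsum_set_const, tsum_subtype {s : ℕ | X s ω ∈ A} fun _ => c]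
  rfl

lemma tsum_simpleFunc_eq_sum_pointCount_mul (f : SimpleFunc Plane ℝ≥0∞) (ω : Ω) :
    ∑' s, f (X s ω) = ∑ y : f.range, pointCount X (f ⁻¹' {(y : ℝ≥0∞)}) ω * (y : ℝ≥0∞) := by
  simp_rw [← tsum_indicator_eq_pointCount_mul]
  rw [← Summable.tsum_finsetSum fun _ _ => ENNReal.summable]
  refine tsum_congr fun s => ?_
  rw [Finset.sum_eq_single (⟨f (X s ω), f.mem_range_self _⟩ : f.range)]
  · simp
  · exact fun y _ hy => indicator_of_notMem (fun h => hy (Subtype.ext h.symm)) _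
  · simp

end PointCount

lemma lintegral_comp_simpleFunc {α : Type*} [MeasurableSpace α] (ν : Measure α)
    (f : SimpleFunc α ℝ≥0∞) (g : ℝ≥0∞ → ℝ≥0∞) :
    ∫⁻ x, g (f x) ∂ν = ∑ y : f.range, g y * ν (f ⁻¹' {(y : ℝ≥0∞)}) := by
  rw [Finset.sum_coe_sort f.range fun y => g y * ν (f ⁻¹' {y}), ← SimpleFunc.map_lintegral,
    ← SimpleFunc.lintegral_eq_lintegral]
  rfl

lemma exists_finMeasSupp_monotone_tendsto {α : Type*} [MeasurableSpace α] (ν : Measure α)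
    [SigmaFinite ν] {g : α → ℝ≥0∞} (hg : Measurable g) :
    ∃ f : ℕ → SimpleFunc α ℝ≥0∞, (∀ n, (f n).FinMeasSupp ν) ∧ (∀ x, Monotone fun n => f n x) ∧
      ∀ x, Tendsto (fun n => f n x) atTop (𝓝 (g x)) := by
  have happly : ∀ n x, (SimpleFunc.eapprox g n).restrict (spanningSets ν n) x =
      (spanningSets ν n).indicator (SimpleFunc.eapprox g n) x := fun n =>
    SimpleFunc.restrict_apply _ (measurableSet_spanningSets ν n)
  refine ⟨fun n => (SimpleFunc.eapprox g n).restrict (spanningSets ν n), fun n => ?_,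
    fun x m n hmn => ?_, fun x => ?_⟩
  · refine SimpleFunc.finMeasSupp_iff_support.2
      ((measure_mono fun x hx => ?_).trans_lt (measure_spanningSets_lt_top ν n))
    rw [Function.mem_support, happly] at hx
    exact mem_of_indicator_ne_zero hx
  · simp only [happly]
    exact (indicator_le_indicator (SimpleFunc.monotone_eapprox g hmn x)).trans
      (indicator_le_indicator_of_subset (monotone_spanningSets ν hmn) (fun _ => zero_le) x)
  · have hlim := tendsto_atTop_iSup fun m n hmn => SimpleFunc.monotone_eapprox g hmn x
    rw [SimpleFunc.iSup_eapprox_apply hg] at hlim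
    refine hlim.congr' ?_
    filter_upwards [eventually_ge_atTop (spanningSetsIndex ν x)] with n hn
    rw [happly, indicator_of_mem (mem_spanningSets_of_index_le ν x hn)]

namespace IsPoissonPointProcess

variable {Ω : Type*} [MeasurableSpace Ω] {μ : Measure Ω} {X : ℕ → Ω → Plane} {lam : ℝ}

lemma isProbabilityMeasure (hX : IsPoissonPointProcess μ X lam) : IsProbabilityMeasure μ :=
  (hX.count_law ∅ .empty (by simp)).isProbabilityMeasure_iff.2
    (Measure.isProbabilityMeasure_map (measurable_of_countable _).aemeasurable)

lemma lintegral_expNeg_pointCount (hX : IsPoissonPointProcess μ X lam) {A : Set Plane}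
    (hA : MeasurableSet A) (hv : volume A ≠ ∞) (c : ℝ≥0∞) :
    ∫⁻ ω, expNeg (pointCount X A ω * c) ∂μ =
      expNeg (ENNReal.ofReal lam * ((1 - expNeg c) * volume A)) := by
  have hm : Measurable fun n : ℕ∞ => expNeg (n * c) := measurable_of_countable _
  rw [(hX.count_law A hA hv).lintegral_comp hm.aemeasurable,
    lintegral_map hm (measurable_of_countable _)]
  simp only [ENat.toENNReal_coe]
  rw [lintegral_expNeg_poissonMeasure, ENNReal.coe_mul, ENNReal.coe_toNNReal hv, ENNReal.ofReal,
    mul_assoc, mul_comm (volume A)]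

lemma measurable_pointCount_mul (hX : IsPoissonPointProcess μ X lam) {A : Set Plane}
    (hA : MeasurableSet A) (c : ℝ≥0∞) : Measurable fun ω => pointCount X A ω * c := by
  simp_rw [← tsum_indicator_eq_pointCount_mul]
  exact Measurable.tsum fun s => (measurable_const.indicator hA).comp (hX.measurable s)

lemma iIndepFun_pointCount (hX : IsPoissonPointProcess μ X lam) {ι : Type*} [Finite ι]
    {A : ι → Set Plane} (hA : ∀ i, MeasurableSet (A i))
    (hd : Pairwise fun i j => Disjoint (A i) (A j)) :
    iIndepFun (fun i => pointCount X (A i)) μ := by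
  have e := Finite.equivFin ι
  simpa using (hX.count_indep _ (fun k => A (e.symm k)) (fun k => hA _)
    fun i j hij => hd (e.symm.injective.ne hij)).precomp e.injective

lemma lintegral_expNeg_tsum_simpleFunc (hX : IsPoissonPointProcess μ X lam)
    (f : SimpleFunc Plane ℝ≥0∞) (hf : f.FinMeasSupp volume) :
    ∫⁻ ω, expNeg (∑' s, f (X s ω)) ∂μ =
      expNeg (ENNReal.ofReal lam * ∫⁻ x, (1 - expNeg (f x))) := by
  have := hX.isProbabilityMeasure
  have hmeas : ∀ y : f.range, MeasurableSet (f ⁻¹' {(y : ℝ≥0∞)}) := fun _ =>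
    f.measurableSet_preimage _
  have hdisj : Pairwise fun y z : f.range => Disjoint (f ⁻¹' {(y : ℝ≥0∞)}) (f ⁻¹' {↑z}) :=
    fun y z hyz => Disjoint.preimage _ (by simpa using fun h => hyz (Subtype.ext h))
  have hind : iIndepFun
      (fun (y : f.range) ω => expNeg (pointCount X (f ⁻¹' {(y : ℝ≥0∞)}) ω * (y : ℝ≥0∞))) μ :=
    (hX.iIndepFun_pointCount hmeas hdisj).comp (fun y n => expNeg (n * (y : ℝ≥0∞)))
      fun _ => measurable_of_countable _
  simp_rw [tsum_simpleFunc_eq_sum_pointCount_mul, expNeg_sum]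
  rw [lintegral_prod_eq_prod_lintegral_of_indepFun _ _ hind
      fun y => measurable_expNeg.comp (hX.measurable_pointCount_mul (hmeas y) y),
    lintegral_comp_simpleFunc volume f fun y => 1 - expNeg y, Finset.mul_sum, expNeg_sum]
  refine Finset.prod_congr rfl fun y _ => ?_
  obtain hy | hy := eq_or_ne (y : ℝ≥0∞) 0
  · simp [hy]
  · exact hX.lintegral_expNeg_pointCount (hmeas y) (hf.meas_preimage_singleton_ne_zero hy).ne _

theorem lintegral_expNeg_tsum (hX : IsPoissonPointProcess μ X lam) {g : Plane → ℝ≥0∞}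
    (hg : Measurable g) :
    ∫⁻ ω, expNeg (∑' s, g (X s ω)) ∂μ =
      expNeg (ENNReal.ofReal lam * ∫⁻ x, (1 - expNeg (g x))) := by
  have := hX.isProbabilityMeasure
  obtain ⟨f, hfin, hmono, hlim⟩ := exists_finMeasSupp_monotone_tendsto volume hg
  have hsum : ∀ ω, Tendsto (fun n => ∑' s, f n (X s ω)) atTop (𝓝 (∑' s, g (X s ω))) := fun ω => by
    simp_rw [← lintegral_count]
    exact lintegral_tendsto_of_tendsto_of_monotone
      (fun _ => (measurable_of_countable _).aemeasurable)
      (ae_of_all _ fun _ => hmono _) (ae_of_all _ fun _ => hlim _)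
  have hintegral : Tendsto (fun n => ∫⁻ x, (1 - expNeg (f n x))) atTop
      (𝓝 (∫⁻ x, (1 - expNeg (g x)))) :=
    lintegral_tendsto_of_tendsto_of_monotone
      (fun n => (measurable_const.sub (measurable_expNeg.comp (f n).measurable)).aemeasurable)
      (ae_of_all _ fun x m n hmn => tsub_le_tsub_left (antitone_expNeg (hmono x hmn)) _)
      (ae_of_all _ fun x => ENNReal.Tendsto.sub tendsto_const_nhds
        ((continuous_expNeg.tendsto _).comp (hlim x)) (Or.inl ENNReal.one_ne_top))
  have hleft := tendsto_lintegral_expNeg (μ := μ)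
    (fun n => Measurable.tsum fun s => (f n).measurable.comp (hX.measurable s)) hsum
  have hright := (continuous_expNeg.tendsto _).comp
    (ENNReal.Tendsto.const_mul hintegral (Or.inr (ENNReal.ofReal_ne_top (r := lam))))
  exact tendsto_nhds_unique
    (hleft.congr fun n => hX.lintegral_expNeg_tsum_simpleFunc (f n) (hfin n)) hright

theorem lintegral_expNeg_tsum_mark (hX : IsPoissonPointProcess μ X lam) {β : Type*}
    [MeasurableSpace β] {M : ℕ → Ω → β} (hM : ∀ s, Measurable (M s)) (hindM : iIndepFun M μ)
    (hindXM : IndepFun (fun ω s => X s ω) (fun ω s => M s ω) μ) {f : Plane × β → ℝ≥0∞}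
    (hf : Measurable f) {ψ : Plane → ℝ≥0∞}
    (hψ : ∀ s x, ∫⁻ ω, expNeg (f (x, M s ω)) ∂μ = ψ x) :
    ∫⁻ ω, expNeg (∑' s, f (X s ω, M s ω)) ∂μ =
      expNeg (ENNReal.ofReal lam * ∫⁻ x, (1 - ψ x)) := by
  have := hX.isProbabilityMeasure
  have hψ_le : ∀ x, ψ x ≤ 1 := fun x => by
    simpa [hψ] using lintegral_mono (μ := μ) fun ω => expNeg_le_one (f (x, M 0 ω))
  have hψ_meas : Measurable ψ := by
    simp_rw [← funext (hψ 0)]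
    exact (measurable_expNeg.comp
      (hf.comp (measurable_fst.prodMk ((hM 0).comp measurable_snd)))).lintegral_prod_right'
  -- For fixed locations, averaging over the marks replaces `f (x, ·)` by `g x`.
  let g : Plane → ℝ≥0∞ := fun x => (-ENNReal.log (ψ x)).toENNReal
  have hg : Measurable g := by fun_prop
  have hexp_g : ∀ x, expNeg (g x) = ψ x := fun x => expNeg_toENNReal_neg_log (hψ_le x)
  have hinner : ∀ ω, ∫⁻ ω', expNeg (∑' s, f (X s ω, M s ω')) ∂μ = expNeg (∑' s, g (X s ω)) :=
    fun ω => lintegral_expNeg_tsum_of_iIndepFun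
      (fun s => hf.comp (measurable_const.prodMk (hM s)))
      (hindM.comp (fun s m => f (X s ω, m)) fun _ => hf.comp measurable_prodMk_left)
      fun s => (hψ s _).trans (hexp_g _).symm
  have hF : Measurable fun z : (ℕ → Plane) × (ℕ → β) => expNeg (∑' s, f (z.1 s, z.2 s)) :=
    measurable_expNeg.comp (Measurable.tsum fun s => hf.comp (by fun_prop))
  rw [lintegral_comp_of_indepFun hindXM (measurable_pi_lambda _ hX.measurable)
    (measurable_pi_lambda _ hM) hF]
  simp_rw [hinner, hX.lintegral_expNeg_tsum hg, hexp_g]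

end IsPoissonPointProcess

/-! ### The Rayleigh distribution -/

lemma lintegral_Ioi_mul_exp_neg_mul_sq {a b : ℝ} (ha : 0 ≤ a) (hb : 0 < b) :
    ∫⁻ x in Ioi a, ENNReal.ofReal (x * Real.exp (-(b * x ^ 2))) =
      ENNReal.ofReal (Real.exp (-(b * a ^ 2)) / (2 * b)) := by
  have hderiv : ∀ x : ℝ, HasDerivAt (fun x => -(Real.exp (-(b * x ^ 2)) / (2 * b)))
      (x * Real.exp (-(b * x ^ 2))) x := fun x => by
    refine (((((hasDerivAt_pow 2 x).const_mul b).fun_neg.exp).div_const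
      (2 * b)).fun_neg).congr_deriv ?_
    field_simp
    ring
  have hlim : Tendsto (fun x : ℝ => -(Real.exp (-(b * x ^ 2)) / (2 * b))) atTop (𝓝 0) := by
    have hsq : Tendsto (fun x : ℝ => b * x ^ 2) atTop atTop :=
      (tendsto_pow_atTop two_ne_zero).const_mul_atTop hb
    simpa using ((Real.tendsto_exp_neg_atTop_nhds_zero.comp hsq).div_const (2 * b)).neg
  have hnonneg : ∀ x ∈ Ioi a, 0 ≤ x * Real.exp (-(b * x ^ 2)) := fun x hx =>
    mul_nonneg (ha.trans (le_of_lt hx)) (Real.exp_pos _).le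
  have hcont := (hderiv a).continuousAt.continuousWithinAt (s := Ici a)
  have hint := integrableOn_Ioi_deriv_of_nonneg hcont (fun x _ => hderiv x) hnonneg hlim
  rw [← ofReal_integral_eq_lintegral_ofReal hint (ae_restrict_of_forall_mem measurableSet_Ioi
    hnonneg), integral_Ioi_of_hasDerivAt_of_tendsto hcont (fun x _ => hderiv x) hint hlim]
  simp

section Rayleigh

variable {sigma : ℝ}

lemma measurable_rayleighDensity : Measurable fun x : ℝ =>
    ENNReal.ofReal (if 0 < x then x / sigma ^ 2 * Real.exp (-x ^ 2 / (2 * sigma ^ 2)) else 0) :=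
  ENNReal.measurable_ofReal.comp (Measurable.ite measurableSet_Ioi (by fun_prop) measurable_const)

lemma rayleighMeasure_Iic_zero : rayleighMeasure sigma (Iic 0) = 0 := by
  rw [rayleighMeasure, withDensity_apply _ measurableSet_Iic]
  exact (setLIntegral_congr_fun measurableSet_Iic fun x hx => by
    simp [not_lt.2 (mem_Iic.1 hx)]).trans lintegral_zero

lemma setLIntegral_Ioi_expNeg_rayleighMeasure (hσ : 0 < sigma) {a c : ℝ} (ha : 0 ≤ a)
    (hc : 0 ≤ c) :
    ∫⁻ x in Ioi a, expNeg (ENNReal.ofReal (c * x ^ 2)) ∂(rayleighMeasure sigma) =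
      ENNReal.ofReal (Real.exp (-((1 / (2 * sigma ^ 2) + c) * a ^ 2)) /
        (1 + 2 * sigma ^ 2 * c)) := by
  set b : ℝ := 1 / (2 * sigma ^ 2) + c with hb
  have hb0 : 0 < b := by positivity
  have hdensity : ∀ x ∈ Ioi a, ENNReal.ofReal (if 0 < x then
      x / sigma ^ 2 * Real.exp (-x ^ 2 / (2 * sigma ^ 2)) else 0) *
        expNeg (ENNReal.ofReal (c * x ^ 2)) =
      ENNReal.ofReal (1 / sigma ^ 2) * ENNReal.ofReal (x * Real.exp (-(b * x ^ 2))) :=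
    fun x hx => by
    have hx0 : 0 < x := ha.trans_lt hx
    have hexp : Real.exp (-(b * x ^ 2)) =
        Real.exp (-x ^ 2 / (2 * sigma ^ 2)) * Real.exp (-(c * x ^ 2)) := by
      rw [← Real.exp_add, hb]; ring_nf
    rw [if_pos hx0, expNeg_ofReal (by positivity), ← ENNReal.ofReal_mul (by positivity),
      ← ENNReal.ofReal_mul (by positivity), hexp]
    ring_nf
  rw [rayleighMeasure, setLIntegral_withDensity_eq_setLIntegral_mul _ measurable_rayleighDensity
    (by fun_prop) measurableSet_Ioi]
  simp only [Pi.mul_apply]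
  rw [setLIntegral_congr_fun measurableSet_Ioi hdensity, lintegral_const_mul _ (by fun_prop),
    lintegral_Ioi_mul_exp_neg_mul_sq ha hb0, ← ENNReal.ofReal_mul (by positivity), hb]
  congr 1
  field_simp

lemma rayleighMeasure_Ioi (hσ : 0 < sigma) {a : ℝ} (ha : 0 ≤ a) :
    rayleighMeasure sigma (Ioi a) = ENNReal.ofReal (Real.exp (-(a ^ 2 / (2 * sigma ^ 2)))) := by
  simpa [div_eq_inv_mul] using setLIntegral_Ioi_expNeg_rayleighMeasure hσ ha le_rfl

lemma lintegral_expNeg_sq_rayleighMeasure (hσ : 0 < sigma) {c : ℝ} (hc : 0 ≤ c) :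
    ∫⁻ x, expNeg (ENNReal.ofReal (c * x ^ 2)) ∂(rayleighMeasure sigma) =
      ENNReal.ofReal (1 / (1 + 2 * sigma ^ 2 * c)) := by
  have hpos : ∀ᵐ x ∂(rayleighMeasure sigma), x ∈ Ioi (0 : ℝ) := by
    simpa [ae_iff, Iic] using rayleighMeasure_Iic_zero
  rw [← Measure.restrict_eq_self_of_ae_mem hpos]
  simpa using setLIntegral_Ioi_expNeg_rayleighMeasure hσ le_rfl hc

end Rayleigh

/-! ### The interference integral -/

lemma lintegral_Ioi_rpow_mul_exp_neg_mul_rpow {p q b : ℝ} (hp : 0 < p) (hq : -1 < q)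
    (hb : 0 < b) :
    ∫⁻ x in Ioi (0 : ℝ), ENNReal.ofReal (x ^ q * Real.exp (-b * x ^ p)) =
      ENNReal.ofReal (b ^ (-(q + 1) / p) * (1 / p) * Real.Gamma ((q + 1) / p)) := by
  rw [← integral_rpow_mul_exp_neg_mul_rpow hp hq hb, ofReal_integral_eq_lintegral_ofReal
    (integrableOn_rpow_mul_exp_neg_mul_rpow hq hp hb)]
  exact ae_restrict_of_forall_mem measurableSet_Ioi fun x hx =>
    mul_nonneg (Real.rpow_nonneg (le_of_lt hx) _) (Real.exp_pos _).le

lemma lintegral_Ioi_rpow_mul_exp_neg_mul {q b : ℝ} (hq : -1 < q) (hb : 0 < b) :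
    ∫⁻ x in Ioi (0 : ℝ), ENNReal.ofReal (x ^ q * Real.exp (-b * x)) =
      ENNReal.ofReal (b ^ (-(q + 1)) * Real.Gamma (q + 1)) := by
  simpa using lintegral_Ioi_rpow_mul_exp_neg_mul_rpow one_pos hq hb

lemma ofReal_inv_eq_lintegral_exp {b : ℝ} (hb : 0 < b) :
    ENNReal.ofReal b⁻¹ = ∫⁻ u in Ioi (0 : ℝ), ENNReal.ofReal (Real.exp (-b * u)) := by
  simpa [Real.rpow_neg_one] using (lintegral_Ioi_rpow_mul_exp_neg_mul neg_one_lt_zero hb).symm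

lemma lintegral_Ioi_rpow_mul_exp_neg_rpow_add_mul {s α T u : ℝ} (hs : 0 < s) (hα : 0 < α)
    (hu : 0 < u) :
    ∫⁻ y in Ioi (0 : ℝ), ENNReal.ofReal (y ^ (s - 1) * Real.exp (-(y ^ α + T) * u)) =
      ENNReal.ofReal (1 / α * Real.Gamma (s / α)) *
        ENNReal.ofReal (u ^ (-(s / α)) * Real.exp (-T * u)) := by
  have hsplit : ∀ y : ℝ, y ^ (s - 1) * Real.exp (-(y ^ α + T) * u) =
      Real.exp (-T * u) * (y ^ (s - 1) * Real.exp (-u * y ^ α)) := fun y => by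
    rw [show -(y ^ α + T) * u = -T * u + -u * y ^ α by ring, Real.exp_add]; ring
  simp_rw [hsplit, ENNReal.ofReal_mul (Real.exp_pos _).le]
  rw [lintegral_const_mul _ (by fun_prop), lintegral_Ioi_rpow_mul_exp_neg_mul_rpow hα
    (by linarith) hu, ← ENNReal.ofReal_mul (by positivity),
    ← ENNReal.ofReal_mul (by positivity), sub_add_cancel, neg_div]
  ring_nf

lemma lintegral_Ioi_rpow_div_rpow_add {s α T : ℝ} (hs : 0 < s) (hsα : s < α) (hT : 0 < T) :
    ∫⁻ y in Ioi (0 : ℝ), ENNReal.ofReal (y ^ (s - 1) / (y ^ α + T)) =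
      ENNReal.ofReal (T ^ (s / α - 1) * (Real.pi / (α * Real.sin (Real.pi * (s / α))))) := by
  have hα : 0 < α := hs.trans hsα
  have hsα' : s / α < 1 := (div_lt_one hα).2 hsα
  -- With `1 / (y ^ α + T)` as a Laplace transform, the integral in `y` becomes a Gamma integral.
  have hlaplace : ∀ y ∈ Ioi (0 : ℝ), ENNReal.ofReal (y ^ (s - 1) / (y ^ α + T)) =
      ∫⁻ u in Ioi (0 : ℝ),
        ENNReal.ofReal (y ^ (s - 1) * Real.exp (-(y ^ α + T) * u)) := fun y hy => by
    have hy0 : 0 < y := hy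
    simp_rw [ENNReal.ofReal_mul (Real.rpow_nonneg hy0.le (s - 1))]
    rw [lintegral_const_mul _ (by fun_prop), ← ofReal_inv_eq_lintegral_exp (by positivity),
      ← ENNReal.ofReal_mul (by positivity), div_eq_mul_inv]
  rw [setLIntegral_congr_fun measurableSet_Ioi hlaplace, lintegral_lintegral_swap (by fun_prop),
    setLIntegral_congr_fun measurableSet_Ioi fun u hu =>
      lintegral_Ioi_rpow_mul_exp_neg_rpow_add_mul hs hα hu,
    lintegral_const_mul _ (by fun_prop), lintegral_Ioi_rpow_mul_exp_neg_mul (by linarith) hT,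
    ← ENNReal.ofReal_mul (by positivity)]
  congr 1
  calc
    1 / α * Real.Gamma (s / α) * (T ^ (-(-(s / α) + 1)) * Real.Gamma (-(s / α) + 1)) =
        T ^ (s / α - 1) * (Real.Gamma (s / α) * Real.Gamma (1 - s / α) / α) := by
      ring_nf
    _ = T ^ (s / α - 1) * (Real.pi / (α * Real.sin (Real.pi * (s / α)))) := by
      rw [Real.Gamma_mul_Gamma_one_sub, div_div, mul_comm α]

lemma lintegral_fun_norm_addHaar {E : Type*} [NormedAddCommGroup E] [NormedSpace ℝ E]
    [Nontrivial E] [FiniteDimensional ℝ E] [MeasurableSpace E] [BorelSpace E] (ν : Measure E)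
    [ν.IsAddHaarMeasure] {f : ℝ → ℝ≥0∞} (hf : Measurable f) :
    ∫⁻ x, f ‖x‖ ∂ν = Module.finrank ℝ E * ν (Metric.ball 0 1) *
      ∫⁻ y in Ioi (0 : ℝ), ENNReal.ofReal (y ^ (Module.finrank ℝ E - 1)) * f y := by
  set n := Module.finrank ℝ E
  calc
    ∫⁻ x, f ‖x‖ ∂ν = ∫⁻ x : ({0}ᶜ : Set E), f ‖x.1‖ ∂(ν.comap (↑)) := by
      rw [lintegral_subtype_comap (measurableSet_singleton _).compl fun x => f ‖x‖,
        restrict_compl_singleton]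
    _ = ∫⁻ x, f x.2 ∂(ν.toSphere.prod (.volumeIoiPow (n - 1))) := by
      simpa using (ν.measurePreserving_homeomorphUnitSphereProd.lintegral_comp
        (f := fun z => f z.2) (by fun_prop))
    _ = ν.toSphere univ * ∫⁻ y : Ioi (0 : ℝ), f y ∂(.volumeIoiPow (n - 1)) := by
      rw [lintegral_prod _ (by fun_prop), mul_comm]
      simp only [lintegral_const]
    _ = n * ν (Metric.ball 0 1) * ∫⁻ y in Ioi (0 : ℝ), ENNReal.ofReal (y ^ (n - 1)) * f y := by
      rw [ν.toSphere_apply_univ, Measure.volumeIoiPow,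
        lintegral_withDensity_eq_lintegral_mul _ (by fun_prop) (by fun_prop),
        ← lintegral_subtype_comap measurableSet_Ioi]
      rfl

lemma lintegral_plane_norm {f : ℝ → ℝ≥0∞} (hf : Measurable f) :
    ∫⁻ x : Plane, f ‖x‖ =
      ENNReal.ofReal (2 * Real.pi) * ∫⁻ y in Ioi (0 : ℝ), ENNReal.ofReal y * f y := by
  rw [lintegral_fun_norm_addHaar volume hf, finrank_euclideanSpace_fin,
    EuclideanSpace.volume_ball_fin_two, ENNReal.ofReal_mul zero_le_two]
  simp

namespace Params

variable (P : Params)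

lemma sin_two_pi_div_α_pos : 0 < Real.sin (2 * Real.pi / P.α) := by
  have hα := P.two_lt_α
  refine Real.sin_pos_of_pos_of_lt_pi (by positivity) ?_
  rw [div_lt_iff₀ (by linarith)]
  nlinarith [Real.pi_pos]

lemma kappa_pos : 0 < P.kappa := by
  have hα := P.two_lt_α
  have hsin := P.sin_two_pi_div_α_pos
  unfold kappa
  positivity

lemma lintegral_one_sub_convexComb_dist_rpow (z : Plane) {a T : ℝ} (ha : 0 ≤ a) (ha1 : a ≤ 1)
    (hT : 0 < T) :
    ∫⁻ x : Plane, (1 - ENNReal.ofReal (1 - a + a * (1 / (1 + T * dist x z ^ (-P.α))))) =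
      ENNReal.ofReal (a * T ^ (2 / P.α) * P.kappa) := by
  have hα := P.two_lt_α
  have hintegrand : ∀ᵐ x : Plane,
      1 - ENNReal.ofReal (1 - a + a * (1 / (1 + T * dist x z ^ (-P.α)))) =
        ENNReal.ofReal (a * T) * ENNReal.ofReal (‖x - z‖ ^ P.α + T)⁻¹ := by
    filter_upwards [compl_mem_ae_iff.2 (measure_singleton z)] with x hx
    have hr : 0 < ‖x - z‖ := norm_pos_iff.2 (sub_ne_zero.2 hx)
    have hnonneg : 0 ≤ a * (1 / (1 + T * (‖x - z‖ ^ P.α)⁻¹)) := by positivity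
    rw [dist_eq_norm, Real.rpow_neg hr.le, ← ENNReal.ofReal_one,
      ← ENNReal.ofReal_sub _ (by linarith), ← ENNReal.ofReal_mul (by positivity)]
    congr 1
    field_simp
    ring
  have hradial : ∫⁻ y in Ioi (0 : ℝ), ENNReal.ofReal y * ENNReal.ofReal (y ^ P.α + T)⁻¹ =
      ENNReal.ofReal (T ^ (2 / P.α - 1) *
        (Real.pi / (P.α * Real.sin (Real.pi * (2 / P.α))))) := by
    rw [← lintegral_Ioi_rpow_div_rpow_add two_pos hα hT]
    refine setLIntegral_congr_fun measurableSet_Ioi fun y hy => ?_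
    rw [← ENNReal.ofReal_mul (le_of_lt hy), div_eq_mul_inv]
    norm_num
  rw [lintegral_congr_ae hintegrand, lintegral_const_mul _ (by fun_prop),
    lintegral_sub_right_eq_self (fun x : Plane => ENNReal.ofReal (‖x‖ ^ P.α + T)⁻¹) z,
    lintegral_plane_norm (f := fun y => ENNReal.ofReal (y ^ P.α + T)⁻¹) (by fun_prop), hradial,
    ← ENNReal.ofReal_mul (by positivity), ← ENNReal.ofReal_mul (by positivity), kappa,
    Real.rpow_sub_one hT.ne', mul_div_left_comm Real.pi]
  congr 1
  field_simp

end Params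

/-! ### Energy balance in the battery -/

lemma sum_queueMatrix_mul (p q : ℝ) (B : ℕ) (i : Fin (B + 1)) (g : ℕ → ℝ) :
    ∑ j, queueMatrix p q B i j * g j =
      g i + upProb p q B i * (g (i + 1) - g i) + downProb p q i * (g (i - 1) - g i) := by
  have hterm : ∀ j : Fin (B + 1), queueMatrix p q B i j * g j =
      (if (j : ℕ) = i + 1 then upProb p q B i * g (i + 1) else 0) +
      (if (i : ℕ) = j + 1 then downProb p q i * g (i - 1) else 0) +
      (if i = j then (1 - upProb p q B i - downProb p q i) * g i else 0) := fun j => by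
    simp only [queueMatrix, Fin.ext_iff]
    grind
  have hup : ∑ j : Fin (B + 1), (if (j : ℕ) = i + 1 then upProb p q B i * g (i + 1) else 0) =
      upProb p q B i * g (i + 1) := by
    obtain hi | hi := eq_or_ne (i : ℕ) B
    · simp [upProb, hi]
    · have hj : ∀ j : Fin (B + 1), (j : ℕ) = i + 1 ↔ j = ⟨i + 1, by omega⟩ := by simp [Fin.ext_iff]
      simp [hj]
  have hdown : ∑ j : Fin (B + 1), (if (i : ℕ) = j + 1 then downProb p q i * g (i - 1) else 0) =
      downProb p q i * g (i - 1) := by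
    obtain hi | hi := eq_or_ne (i : ℕ) 0
    · simp [downProb, hi]
    · have hj : ∀ j : Fin (B + 1), (i : ℕ) = j + 1 ↔ j = ⟨i - 1, by omega⟩ := by
        simp only [Fin.ext_iff]; omega
      simp [hj]
  simp_rw [hterm, Finset.sum_add_distrib]
  rw [hup, hdown, Finset.sum_ite_eq, if_pos (Finset.mem_univ _)]
  ring

lemma upProb_sub_downProb {p q : ℝ} {B : ℕ} (hB : 1 ≤ B) (i : ℕ) :
    upProb p q B i - downProb p q i =
      p - q * (if 1 ≤ i then 1 else 0) - p * (1 - q) * (if i = B then 1 else 0) := by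
  unfold upProb downProb
  grind

namespace IsStationaryLaw

variable {p q : ℝ} {B : ℕ} {v : Fin (B + 1) → ℝ}

lemma sum_mul_generator_eq_zero (h : IsStationaryLaw p q B v) (g : ℕ → ℝ) :
    ∑ i : Fin (B + 1), v i * (upProb p q B i * (g (i + 1) - g i) +
      downProb p q i * (g (i - 1) - g i)) = 0 := by
  have hinvariant : ∑ i : Fin (B + 1), v i * g i =
      ∑ i, v i * ∑ j : Fin (B + 1), queueMatrix p q B i j * g j := by
    calc
      ∑ i : Fin (B + 1), v i * g i = Matrix.vecMul v (queueMatrix p q B) ⬝ᵥ fun j => g j := by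
        rw [h.2]; rfl
      _ = ∑ i, v i * ∑ j : Fin (B + 1), queueMatrix p q B i j * g j :=
        (Matrix.dotProduct_mulVec _ _ _).symm
  simp_rw [sum_queueMatrix_mul, add_assoc, mul_add, Finset.sum_add_distrib,
    left_eq_add] at hinvariant
  simp_rw [mul_add, Finset.sum_add_distrib, hinvariant]

lemma energy_balance (h : IsStationaryLaw p q B v) (hB : 1 ≤ B) :
    (∑ k : Fin (B + 1), if 1 ≤ (k : ℕ) then v k else 0) * q =
      p - p * (1 - q) * v (Fin.last B) := by
  have hdrift := h.sum_mul_generator_eq_zero fun n => (n : ℝ)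
  have hterm : ∀ i : Fin (B + 1), v i * (upProb p q B i * (((i + 1 : ℕ) : ℝ) - (i : ℕ)) +
      downProb p q i * (((i - 1 : ℕ) : ℝ) - (i : ℕ))) =
      p * v i - (if 1 ≤ (i : ℕ) then v i else 0) * q -
        p * (1 - q) * (if i = Fin.last B then v i else 0) := fun i => by
    have hdown : downProb p q i * (((i - 1 : ℕ) : ℝ) - (i : ℕ)) = -downProb p q i := by
      obtain hi | hi := Nat.eq_zero_or_pos i
      · simp [downProb, hi]
      · simp [Nat.cast_pred hi]
    have hup : upProb p q B i * (((i + 1 : ℕ) : ℝ) - (i : ℕ)) = upProb p q B i := by simp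
    rw [hdown, hup, ← sub_eq_add_neg, upProb_sub_downProb hB]
    simp only [Fin.ext_iff, Fin.val_last]
    split_ifs <;> ring
  simp_rw [hterm, Finset.sum_sub_distrib, ← Finset.mul_sum, ← Finset.sum_mul, h.1.2,
    Finset.sum_ite_eq', if_pos (Finset.mem_univ _)] at hdrift
  linarith

end IsStationaryLaw

/-! ### The success probability and the equilibria -/

/-- The squared modulus of the fading of a transmitting interferer, and `0` for a silent one, as a
function of its fading, its battery level and its access decision. -/
def fadingGain {B : ℕ} : ℂ × Fin (B + 1) × Bool → ℝ≥0∞ :=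
  {m | 1 ≤ (m.2.1 : ℕ) ∧ m.2.2 = true}.indicator fun m => ENNReal.ofReal (‖m.1‖ ^ 2)

lemma measurable_fadingGain {B : ℕ} : Measurable (fadingGain (B := B)) :=
  Measurable.indicator (by fun_prop) <| measurable_snd <| MeasurableSet.of_discrete
    (s := {m : Fin (B + 1) × Bool | 1 ≤ (m.1 : ℕ) ∧ m.2 = true})

namespace Network

variable {P : Params} {Ω : Type*} [MeasurableSpace Ω] {μ : Measure Ω} (N : Network P μ) {q : ℝ}

lemma activeProb_mul (hq : q ∈ Icc (0 : ℝ) 1) :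
    N.activeProb q * q = P.p - P.p * (1 - q) * N.energyLaw q (Fin.last P.B) :=
  (N.energyLaw_stationary q hq).energy_balance P.one_le_B

lemma activeProb_one_mul : N.activeProb 1 * 1 = P.p := by
  rw [N.activeProb_mul (by simp)]
  ring

lemma activeProb_mul_le (hq : q ∈ Icc (0 : ℝ) 1) : N.activeProb q * q ≤ P.p := by
  rw [N.activeProb_mul hq, sub_le_self_iff]
  exact mul_nonneg (mul_nonneg P.p_pos.le (sub_nonneg.2 hq.2))
    ((N.energyLaw_stationary q hq).1.1 _)

lemma activeProb_mul_nonneg (hq : q ∈ Icc (0 : ℝ) 1) : 0 ≤ N.activeProb q * q := by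
  refine mul_nonneg (Finset.sum_nonneg fun k _ => ?_) hq.1
  split_ifs
  · exact (N.energyLaw_stationary q hq).1.1 k
  · exact le_rfl

lemma measure_one_le_energy [IsFiniteMeasure μ] (hq : q ∈ Icc (0 : ℝ) 1) (s : ℕ) :
    μ (N.energy q s ⁻¹' {k | 1 ≤ (k : ℕ)}) = ENNReal.ofReal (N.activeProb q) := by
  have hcoe : {k : Fin (P.B + 1) | 1 ≤ (k : ℕ)} =
      (Finset.univ.filter fun k : Fin (P.B + 1) => 1 ≤ (k : ℕ) : Finset _) := by
    ext; simp
  rw [← ofReal_measureReal, activeProb, hcoe, ← sum_measureReal_preimage_singleton _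
    fun k _ => N.energy_measurable q hq s (measurableSet_singleton k), Finset.sum_filter]
  simp_rw [← N.energy_law q hq s]
  rfl

lemma measure_transmits [IsFiniteMeasure μ] (hq : q ∈ Icc (0 : ℝ) 1) (s : ℕ) :
    μ {ω | N.Transmits q s ω} = ENNReal.ofReal (N.activeProb q * q) := by
  have haccess : μ (N.access q s ⁻¹' {true}) = ENNReal.ofReal q := by
    rw [← ofReal_measureReal]
    exact congrArg ENNReal.ofReal (N.access_law q hq s)
  calc
    μ {ω | N.Transmits q s ω} =
        μ (N.energy q s ⁻¹' {k | 1 ≤ (k : ℕ)} ∩ N.access q s ⁻¹' {true}) := rfl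
    _ = ENNReal.ofReal (N.activeProb q) * ENNReal.ofReal q := by
      rw [(N.indep_access q hq s).measure_inter_preimage_eq_mul _ _ .of_discrete .of_discrete,
        N.measure_one_le_energy hq s, haccess]
    _ = ENNReal.ofReal (N.activeProb q * q) := (ENNReal.ofReal_mul' hq.1).symm

/-- The channel gain of interferer `s`, path loss excluded, when the interferers use `q`. These
are the marks of the Poisson process in the computation of the interference. -/
def gain (q : ℝ) (s : ℕ) (ω : Ω) : ℝ≥0∞ :=
  fadingGain (N.fading s ω, N.energy q s ω, N.access q s ω)

lemma gain_eq_indicator (q : ℝ) (s : ℕ) :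
    N.gain q s = {ω | N.Transmits q s ω}.indicator fun ω => ENNReal.ofReal (‖N.fading s ω‖ ^ 2) :=
  rfl

lemma interference_eq_tsum_gain (q : ℝ) (ω : Ω) :
    N.interference q ω =
      ∑' s, ENNReal.ofReal (dist (N.loc s ω) N.receiver ^ (-P.α)) * N.gain q s ω := by
  classical
  refine tsum_congr fun s => ?_
  simp only [gain_eq_indicator, indicator_apply, mem_ofPred_eq, Params.rxPower,
    ENNReal.ofReal_mul (Real.rpow_nonneg dist_nonneg _), mul_ite, mul_zero]

lemma measurable_gain (hq : q ∈ Icc (0 : ℝ) 1) (s : ℕ) : Measurable (N.gain q s) :=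
  measurable_fadingGain.comp ((N.fading_measurable s).prodMk
    ((N.energy_measurable q hq s).prodMk (N.access_measurable q hq s)))

lemma iIndepFun_gain (hq : q ∈ Icc (0 : ℝ) 1) : iIndepFun (N.gain q) μ :=
  (N.indep_marks q hq).comp (fun _ => fadingGain) fun _ => measurable_fadingGain

lemma indepFun_ownFading_gain (hq : q ∈ Icc (0 : ℝ) 1) :
    IndepFun N.ownFading (fun ω s => N.gain q s ω) μ :=
  (N.indep_ownFading q hq).comp (φ := id)
    (ψ := fun (m : ℕ → ℂ × Fin (P.B + 1) × Bool) s => fadingGain (m s)) measurable_id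
    (measurable_pi_lambda _ fun s => measurable_fadingGain.comp (measurable_pi_apply s))

lemma indepFun_loc_ownFading_gain (hq : q ∈ Icc (0 : ℝ) 1) :
    IndepFun (fun ω s => N.loc s ω) (fun ω => (N.ownFading ω, fun s => N.gain q s ω)) μ :=
  (N.indep_loc q hq).comp (φ := id)
    (ψ := fun y : ℂ × (ℕ → ℂ × Fin (P.B + 1) × Bool) => (y.1, fun s => fadingGain (y.2 s)))
    measurable_id
    (measurable_fst.prodMk (measurable_pi_lambda _ fun s =>
      measurable_fadingGain.comp ((measurable_pi_apply s).comp measurable_snd)))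

lemma measurable_interference (hq : q ∈ Icc (0 : ℝ) 1) : Measurable (N.interference q) := by
  have hloc := N.loc_poisson.measurable
  have hgain := N.measurable_gain hq
  rw [funext (N.interference_eq_tsum_gain q)]
  fun_prop

lemma indepFun_ownFading_interference [IsFiniteMeasure μ] (hq : q ∈ Icc (0 : ℝ) 1) :
    IndepFun N.ownFading (N.interference q) μ := by
  have hind : IndepFun N.ownFading (fun ω => (fun s => N.loc s ω, fun s => N.gain q s ω)) μ :=
    indepFun_prodMk_of_indepFun (measurable_pi_lambda _ N.loc_poisson.measurable)
      N.ownFading_measurable (measurable_pi_lambda _ (N.measurable_gain hq))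
      (N.indepFun_loc_ownFading_gain hq) (N.indepFun_ownFading_gain hq)
  rw [funext (N.interference_eq_tsum_gain q)]
  exact hind.comp (φ := id) (ψ := fun z : (ℕ → Plane) × (ℕ → ℝ≥0∞) =>
    ∑' s, ENNReal.ofReal (dist (z.1 s) N.receiver ^ (-P.α)) * z.2 s) measurable_id (by fun_prop)

lemma lintegral_expNeg_gain [IsProbabilityMeasure μ] (hq : q ∈ Icc (0 : ℝ) 1) {c : ℝ} (hc : 0 ≤ c)
    (s : ℕ) :
    ∫⁻ ω, expNeg (ENNReal.ofReal c * N.gain q s ω) ∂μ =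
      ENNReal.ofReal (1 - N.activeProb q * q +
        N.activeProb q * q * (1 / (1 + 2 * P.sigma ^ 2 * c))) := by
  set a := N.activeProb q * q
  have ha0 : 0 ≤ a := N.activeProb_mul_nonneg hq
  have ha1 : a ≤ 1 := (N.activeProb_mul_le hq).trans P.p_le_one
  let activity : Ω → Fin (P.B + 1) × Bool := fun ω => (N.energy q s ω, N.access q s ω)
  let active : Set (Fin (P.B + 1) × Bool) := {m | 1 ≤ (m.1 : ℕ) ∧ m.2 = true}
  have hactivity : Measurable activity :=
    (N.energy_measurable q hq s).prodMk (N.access_measurable q hq s)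
  have hactive : μ (activity ⁻¹' active) = ENNReal.ofReal a := N.measure_transmits hq s
  have hsilent : μ (activity ⁻¹' active)ᶜ = ENNReal.ofReal (1 - a) := by
    rw [prob_compl_eq_one_sub (hactivity .of_discrete), hactive, ENNReal.ofReal_sub _ ha0,
      ENNReal.ofReal_one]
  have hpower : ∀ ω, ENNReal.ofReal c * N.gain q s ω = (activity ⁻¹' active).indicator
      (fun ω => ENNReal.ofReal (c * ‖N.fading s ω‖ ^ 2)) ω := fun ω => by
    simp_rw [ENNReal.ofReal_mul hc, indicator_const_mul]
    rfl
  have hfading : ∫⁻ ω, expNeg (ENNReal.ofReal (c * ‖N.fading s ω‖ ^ 2)) ∂μ =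
      ENNReal.ofReal (1 / (1 + 2 * P.sigma ^ 2 * c)) := by
    rw [← lintegral_expNeg_sq_rayleighMeasure P.sigma_pos hc,
      ← (N.fading_law s).lintegral_comp (by fun_prop)]
  have hmeas := N.fading_measurable s
  have hind : IndepFun (fun ω => ENNReal.ofReal (c * ‖N.fading s ω‖ ^ 2)) activity μ :=
    (N.indep_fading q hq s).comp (φ := fun h => ENNReal.ofReal (c * ‖h‖ ^ 2)) (ψ := id)
      (by fun_prop) measurable_id
  simp_rw [hpower]
  rw [lintegral_expNeg_indicator_of_indepFun (by fun_prop) hactivity hind .of_discrete,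
    hactive, hsilent, hfading, ← ENNReal.ofReal_mul ha0,
    ← ENNReal.ofReal_add (by positivity) (sub_nonneg.2 ha1), add_comm]

theorem lintegral_expNeg_interference [IsProbabilityMeasure μ] (hq : q ∈ Icc (0 : ℝ) 1) {c : ℝ}
    (hc : 0 < c) :
    ∫⁻ ω, expNeg (ENNReal.ofReal c * N.interference q ω) ∂μ =
      expNeg (ENNReal.ofReal (P.lam *
        (N.activeProb q * q * (2 * P.sigma ^ 2 * c) ^ (2 / P.α) * P.kappa))) := by
  have hσ := P.sigma_pos
  let f : Plane × ℝ≥0∞ → ℝ≥0∞ := fun z =>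
    ENNReal.ofReal c * (ENNReal.ofReal (dist z.1 N.receiver ^ (-P.α)) * z.2)
  have hf : Measurable f := by fun_prop
  have hmark : ∀ s x, ∫⁻ ω, expNeg (f (x, N.gain q s ω)) ∂μ =
      ENNReal.ofReal (1 - N.activeProb q * q + N.activeProb q * q *
        (1 / (1 + 2 * P.sigma ^ 2 * c * dist x N.receiver ^ (-P.α)))) := fun s x => by
    simp_rw [f, ← mul_assoc (ENNReal.ofReal c), ← ENNReal.ofReal_mul hc.le]
    rw [N.lintegral_expNeg_gain hq (by positivity), mul_assoc (2 * P.sigma ^ 2)]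
  simp_rw [interference_eq_tsum_gain, ← ENNReal.tsum_mul_left]
  rw [N.loc_poisson.lintegral_expNeg_tsum_mark (N.measurable_gain hq) (N.iIndepFun_gain hq)
    ((N.indepFun_loc_ownFading_gain hq).comp measurable_id measurable_snd) hf hmark,
    P.lintegral_one_sub_convexComb_dist_rpow _ (N.activeProb_mul_nonneg hq)
      ((N.activeProb_mul_le hq).trans P.p_le_one) (by positivity),
    ENNReal.ofReal_mul P.lam_pos.le]

lemma measure_lt_rxPower (t : ℝ≥0∞) :
    μ {ω | t < P.rxPower P.d (N.ownFading ω)} =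
      expNeg (ENNReal.ofReal (P.d ^ P.α / (2 * P.sigma ^ 2)) * t) := by
  have hσ := P.sigma_pos
  have hdα : 0 < P.d ^ P.α := Real.rpow_pos_of_pos P.d_pos _
  induction t using ENNReal.recTopCoe with
  | top => simp [ENNReal.mul_top, show 0 < P.d ^ P.α / (2 * P.sigma ^ 2) by positivity]
  | coe t =>
    have hset : {ω | (t : ℝ≥0∞) < P.rxPower P.d (N.ownFading ω)} =
        {ω | √(P.d ^ P.α * t) < ‖N.ownFading ω‖} := by
      ext ω
      rw [mem_ofPred_eq, mem_ofPred_eq, Real.sqrt_lt (by positivity) (norm_nonneg _),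
        Params.rxPower, ← ENNReal.ofReal_coe_nnreal,
        ENNReal.ofReal_lt_ofReal_iff_of_nonneg t.coe_nonneg, Real.rpow_neg P.d_pos.le,
        lt_inv_mul_iff₀ hdα]
    have htail := (N.ownFading_law.measure_eq (p := fun x => √(P.d ^ P.α * t) < x)
      measurableSet_Ioi).trans (rayleighMeasure_Ioi hσ (Real.sqrt_nonneg _))
    rw [hset, htail, Real.sq_sqrt (by positivity),
      ← ENNReal.ofReal_coe_nnreal, ← ENNReal.ofReal_mul (by positivity),
      expNeg_ofReal (by positivity), div_mul_eq_mul_div]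

lemma measure_lt_SIR [IsFiniteMeasure μ] (hq : q ∈ Icc (0 : ℝ) 1) :
    μ {ω | ENNReal.ofReal P.θ < N.SIR q ω} = ∫⁻ ω, expNeg (ENNReal.ofReal
      (P.d ^ P.α / (2 * P.sigma ^ 2) * P.θ) * N.interference q ω) ∂μ := by
  have hσ := P.sigma_pos
  have hrate : 0 < P.d ^ P.α / (2 * P.sigma ^ 2) :=
    div_pos (Real.rpow_pos_of_pos P.d_pos _) (by positivity)
  have hrx : Measurable (P.rxPower P.d) := by
    unfold Params.rxPower
    fun_prop
  simp_rw [ENNReal.ofReal_mul hrate.le, mul_assoc]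
  exact measure_lt_div_eq_lintegral_expNeg (hrx.comp N.ownFading_measurable)
    (N.measurable_interference hq)
    ((N.indepFun_ownFading_interference hq).comp hrx measurable_id)
    (by simpa using hrate) N.measure_lt_rxPower (by simpa using P.θ_pos) ENNReal.ofReal_ne_top

theorem successProb_eq [IsProbabilityMeasure μ] (hq : q ∈ Icc (0 : ℝ) 1) :
    N.successProb q = Real.exp (-(N.activeProb q * q * P.lam / P.lamMax)) := by
  have hd := P.d_pos
  have hθ := P.θ_pos
  have hσ := P.sigma_pos
  have hα := P.two_lt_α
  have hlam := P.lam_pos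
  have hκ := P.kappa_pos
  have ha := N.activeProb_mul_nonneg hq
  have hscale : (2 * P.sigma ^ 2 * (P.d ^ P.α / (2 * P.sigma ^ 2) * P.θ)) ^ (2 / P.α) =
      P.d ^ 2 * P.θ ^ (2 / P.α) := by
    rw [← mul_assoc, mul_div_cancel₀ _ (by positivity), Real.mul_rpow (by positivity) hθ.le,
      ← Real.rpow_mul hd.le, mul_div_cancel₀ _ (by linarith), Real.rpow_two]
  rw [successProb, measureReal_def, N.measure_lt_SIR hq,
    N.lintegral_expNeg_interference hq (by positivity), hscale, expNeg_ofReal (by positivity),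
    ENNReal.toReal_ofReal (Real.exp_pos _).le, Params.lamMax, div_div_eq_mul_div, div_one]
  ring_nf

lemma throughput_eq [IsProbabilityMeasure μ] (hq : q ∈ Icc (0 : ℝ) 1) (x : ℝ) :
    N.throughput x q =
      N.activeProb x * x * (Real.exp (-(N.activeProb q * q * P.lam / P.lamMax)) * P.R) := by
  rw [throughput, N.successProb_eq hq, mul_assoc]

variable {N} in
lemma IsSNE.activeProb_mul_eq [IsProbabilityMeasure μ] (h : N.IsSNE q) :
    N.activeProb q * q = P.p := by
  refine (N.activeProb_mul_le h.1).antisymm ?_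
  have hbest := h.2 1 (by simp)
  rw [N.throughput_eq h.1, N.throughput_eq h.1, N.activeProb_one_mul] at hbest
  exact le_of_mul_le_mul_right hbest (mul_pos (Real.exp_pos _) P.R_pos)

end Network

end EHAloha

end

theorem theorem4 (P : EHAloha.Params) {Ω : Type*} [MeasurableSpace Ω] (μ : Measure Ω)
    [IsProbabilityMeasure μ] (N : EHAloha.Network P μ) :
    N.IsSNE 1 ∧
      ∀ q : ℝ, N.IsSNE q →
        N.throughput q q = P.p * Real.exp (-(P.p * P.lam / P.lamMax)) * P.R ∧
        N.capacity q = P.lam * P.p * Real.exp (-(P.p * P.lam / P.lamMax)) * P.R := by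
  have h1 : (1 : ℝ) ∈ Icc (0 : ℝ) 1 := by simp
  refine ⟨⟨h1, fun x hx => ?_⟩, fun q hq => ?_⟩
  · rw [N.throughput_eq h1, N.throughput_eq h1, N.activeProb_one_mul]
    exact mul_le_mul_of_nonneg_right (N.activeProb_mul_le hx)
      (mul_pos (Real.exp_pos _) P.R_pos).le
  · have h : N.throughput q q = P.p * Real.exp (-(P.p * P.lam / P.lamMax)) * P.R := by
      rw [N.throughput_eq hq.1, hq.activeProb_mul_eq, mul_assoc]
    exact ⟨h, by rw [EHAloha.Network.capacity, h]; ring⟩
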